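/- **Definitions.** Let $X$ be a finite set. Write $1=\{(x,x):x\in X\}$ and, for $r\subseteq X\times X$, $r^*=\{(y,z):(z,y)\in r\}$. An *association scheme* on $X$ is a partition $S$ of $X\times X$ with $1\in S$ and $s^*\in S$ for all $s\in S$, such that for all $p,q,r\in S$ there is an integer $a_{pqr}$ with $|\{w\in X:(y,w)\in p,\ (w,z)\in q\}|=a_{pqr}$ for all $(y,z)\in r$. For $P,Q\subseteq S$, the complex product $PQ$ is the set of all $s\in S$ with $a_{pqs}\neq 0$ for some $p\in P$, $q\in Q$ (a singleton $\{p\}$ is written $p$). A non-empty $R\subseteq S$ is *closed* if $p^*q\subseteq R$ for all $p,q\in R$. The valency of $s\in S$ is $n_s=a_{ss^*1}$, and the valency of a closed subset $T$ is $n_T=\sum_{t\in T}n_t$. For closed subsets $T\subseteq U$, the index of $T$ in $U$ is the integer $n_U/n_T$, and $T$ is *strongly normal* in $U$ if $u^*Tu\subseteq T$ for all $u\in U$. The scheme $S$ is *solvable* if it has closed subsets $T_0,\ldots,T_n$ with $T_0=\{1\}$ and $T_n=S$ such that, for each $i\in\{1,\ldots,n\}$, $T_{i-1}\subseteq T_i$,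 and $T_{i-1}$ is strongly normal and of prime index in $T_i$. Let $\pi$ be a set of primes and $\pi'$ the set of primes not in $\pi$. A positive integer is a *$\pi$-number* if all its prime divisors lie in $\pi$. A closed subset of $S$ (in particular $S$ itself) is *$\pi$-valenced* if the valency of each of its elements is a $\pi$-number. A *closed $\pi$-subset* of $S$ is a $\pi$-valenced closed subset $T$ for which $n_T$ is a $\pi$-number; it is a *Hall $\pi$-subset* of $S$ if moreover its index in $S$ is a $\pi'$-number. Closed subsets $T,U$ of $S$ are *conjugate in $S$* if $s^*Ts=U$ for some $s\in S$. **Theorem.** Let $\pi$ be a set of primes, and let $S$ be a solvable, $\pi$-valenced association scheme on a finite set $X$. Then: (i) $S$ has at least one Hall $\pi$-subset; (ii) any two Hall $\pi$-subsets of $S$ are conjugate in $S$; (iii) every closed $\pi$-subset of $S$ is contained in a Hall $\pi$-subset of $S$. -/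

import Mathlib

universe u

/-- An association scheme on the finite set `X`: a partition of `X × X` (into non-empty blocks,
which forces `X` to be non-empty) that contains the diagonal, is closed under transposition, and is
regular: for all blocks `p`, `q`, `r` the number of `w` with `(y, w) ∈ p` and `(w, z) ∈ q` is the
same for all `(y, z) ∈ r`. -/
structure AssociationScheme (X : Type u) [Finite X] where
  /-- the set of blocks -/
  rels : Set (Set (X × X))
  isPartition : Setoid.IsPartition rels
  one_mem : {a : X × X | a.1 = a.2} ∈ rels
  star_mem : ∀ s ∈ rels, {a : X × X | (a.2, a.1) ∈ s} ∈ rels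
  regular : ∀ p ∈ rels, ∀ q ∈ rels, ∀ r ∈ rels, ∃ k : ℕ, ∀ y z : X, (y, z) ∈ r →
    {w : X | (y, w) ∈ p ∧ (w, z) ∈ q}.ncard = k

namespace AssociationScheme

variable {X : Type u} [Finite X] (S : AssociationScheme X)

/-- The elements of the scheme `S`, as a type. -/
def Elem : Type u := {s : Set (X × X) // s ∈ S.rels}

instance : Finite S.Elem := by
  unfold Elem
  infer_instance

/-- The element `1` of `S`: the diagonal. -/
def one : S.Elem := ⟨{a : X × X | a.1 = a.2}, S.one_mem⟩

/-- The transposed relation `s*`. -/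
def star (s : S.Elem) : S.Elem := ⟨{a : X × X | (a.2, a.1) ∈ s.1}, S.star_mem s.1 s.2⟩

/-- The structure constant `a_{pqr}`; it is unique since `r` is non-empty. -/
noncomputable def structConst (p q r : S.Elem) : ℕ :=
  Classical.choose (S.regular p.1 p.2 q.1 q.2 r.1 r.2)

theorem structConst_spec (p q r : S.Elem) {y z : X} (h : (y, z) ∈ r.1) :
    {w : X | (y, w) ∈ p.1 ∧ (w, z) ∈ q.1}.ncard = S.structConst p q r :=
  Classical.choose_spec (S.regular p.1 p.2 q.1 q.2 r.1 r.2) y z h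

/-- The complex product `PQ` of two subsets of `S`. -/
def complexMul (P Q : Set S.Elem) : Set S.Elem :=
  {s | ∃ p ∈ P, ∃ q ∈ Q, S.structConst p q s ≠ 0}

/-- Closed subsets of `S`. -/
def IsClosedSubset (R : Set S.Elem) : Prop :=
  R.Nonempty ∧ ∀ p ∈ R, ∀ q ∈ R, S.complexMul {S.star p} {q} ⊆ R

/-- The valency `n_s = a_{s s* 1}` of an element of `S`. -/
noncomputable def valency (s : S.Elem) : ℕ := S.structConst s (S.star s) S.one

/-- The valency `n_T` of a subset: the (finite) sum of the valencies of its elements. -/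
noncomputable def setValency (T : Set S.Elem) : ℕ := ∑ᶠ t ∈ T, S.valency t

/-- The set `s* T s`. -/
def conj (s : S.Elem) (T : Set S.Elem) : Set S.Elem :=
  S.complexMul (S.complexMul {S.star s} T) {s}

/-- Two (closed) subsets `T` and `U` are conjugate in `S` if `s* T s = U` for some `s` in `S`. -/
def AreConjugate (T U : Set S.Elem) : Prop := ∃ s : S.Elem, S.conj s T = U

/-- The index of `T` in `U`. It is used only for closed subsets `T ⊆ U`, where `n_T` is positive
and divides `n_U`, so the division is exact. -/
noncomputable def index (T U : Set S.Elem) : ℕ := S.setValency U / S.setValency T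

/-- `T` is strongly normal in `U` (for closed subsets `T` and `U`). -/
def IsStronglyNormalIn (T U : Set S.Elem) : Prop :=
  T ⊆ U ∧ ∀ u ∈ U, S.conj u T ⊆ T

/-- Solvable association schemes. -/
def IsSolvable : Prop :=
  ∃ (n : ℕ) (T : ℕ → Set S.Elem),
    (∀ i ≤ n, S.IsClosedSubset (T i)) ∧ T 0 = {S.one} ∧ T n = Set.univ ∧
    ∀ i < n, S.IsStronglyNormalIn (T i) (T (i + 1)) ∧ (S.index (T i) (T (i + 1))).Prime

/-- A `π`-number: a positive integer all of whose prime divisors belong to `π`. -/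
def IsPiNumber (π : Set ℕ) (n : ℕ) : Prop := 0 < n ∧ ∀ p : ℕ, p.Prime → p ∣ n → p ∈ π

/-- The set `π'` of all primes that do not belong to `π`. -/
def primeCompl (π : Set ℕ) : Set ℕ := {p | p.Prime ∧ p ∉ π}

/-- All elements of the (closed) subset `T` have valency a `π`-number. -/
def IsPiValencedSubset (π : Set ℕ) (T : Set S.Elem) : Prop :=
  ∀ t ∈ T, IsPiNumber π (S.valency t)

/-- The scheme `S` is `π`-valenced. -/
def IsPiValenced (π : Set ℕ) : Prop := S.IsPiValencedSubset π Set.univ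

/-- Closed `π`-subsets of `S`. -/
def IsClosedPiSubset (π : Set ℕ) (T : Set S.Elem) : Prop :=
  S.IsClosedSubset T ∧ S.IsPiValencedSubset π T ∧ IsPiNumber π (S.setValency T)

/-- Hall `π`-subsets of `S`. -/
def IsHallPiSubset (π : Set ℕ) (T : Set S.Elem) : Prop :=
  S.IsClosedPiSubset π T ∧ IsPiNumber (primeCompl π) (S.index T Set.univ)

end AssociationScheme

/-! The theorem reduces to Hall's theorem for a finite solvable group. The main point is that `S`
has a closed subset `P`, strongly normal in `S`, whose valency is a `π`-number. The quotient by `P`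
is then a group `G`, which inherits solvability from `S`. Hall `π`-subsets of `S` are exactly the
preimages of Hall `π`-subgroups of `G`, and conjugation by `s` lies over conjugation by the image of
`s`.

`P` is carried up the series (`IsStronglyNormalIn.of_maximal`). Let `T` be strongly normal in `U`,
and let `P` have largest valency among the closed subsets strongly normal in `T` whose valency is a
`π`-number. For `u ∈ U` put `D = PuP` and `B = D*D`. Strong normality makes `B` a closed subset,
strongly normal in `T`, that stabilises `D` on the right, so `n_B = n_D`. This number divides `n_P
n_u n_P` (`setValency_double_dvd`), and `n_u` is a `π`-number because `S` is `π`-valenced.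
Maximality gives `B = P`, whence `u*Pu ⊆ B = P`.

Hall's theorem itself is proved by induction on the order, through a normal elementary abelian
subgroup and the conjugacy of complements to an abelian normal subgroup of coprime index. -/

open AssociationScheme (IsPiNumber primeCompl)

/-! ### Arithmetic of `π`-numbers -/

namespace AssociationScheme

theorem IsPiNumber.of_dvd {π : Set ℕ} {m n : ℕ} (hn : IsPiNumber π n) (h : m ∣ n) :
    IsPiNumber π m :=
  ⟨Nat.pos_of_dvd_of_pos h hn.1, fun p hp hpm => hn.2 p hp (hpm.trans h)⟩

theorem IsPiNumber.mul {π : Set ℕ} {m n : ℕ} (hm : IsPiNumber π m) (hn : IsPiNumber π n) :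
    IsPiNumber π (m * n) :=
  ⟨Nat.mul_pos hm.1 hn.1, fun p hp h => (hp.dvd_mul.1 h).elim (hm.2 p hp) (hn.2 p hp)⟩

theorem isPiNumber_one (π : Set ℕ) : IsPiNumber π 1 :=
  ⟨one_pos, fun _ hp h => absurd (Nat.dvd_one.1 h) hp.ne_one⟩

theorem IsPiNumber.coprime {π : Set ℕ} {m n : ℕ} (hm : IsPiNumber π m)
    (hn : IsPiNumber (primeCompl π) n) : Nat.Coprime m n :=
  Nat.coprime_of_dvd fun p hp h1 h2 => (hn.2 p hp h2).2 (hm.2 p hp h1)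

theorem isPiNumber_prime_pow {π : Set ℕ} {p : ℕ} (hp : p.Prime) (h : p ∈ π) (k : ℕ) :
    IsPiNumber π (p ^ k) :=
  ⟨pow_pos hp.pos k, fun _ hq hqp => (Nat.prime_dvd_prime_iff_eq hq hp).1
    (hq.dvd_of_dvd_pow hqp) ▸ h⟩

end AssociationScheme

/-! ### Conjugacy of complements to an abelian normal subgroup -/

namespace Subgroup

variable {G : Type*} [Group G]

-- The fixed class is that of `K` itself: `K` is a transversal of `N`, and right multiplication by
-- an element of `K` preserves it.
open MulOpposite MulAction Pointwise in
theorem exists_le_stabilizer_of_isComplement' (N : Subgroup G) [N.Normal] [IsMulCommutative N]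
    [N.FiniteIndex] {K : Subgroup G} (hK : IsComplement' N K) :
    ∃ α : N.QuotientDiff, ∀ k ∈ K, k • α = α := by
  refine ⟨Quotient.mk'' ⟨(K : Set G), hK.symm⟩, fun k hk => ?_⟩
  refine congrArg Quotient.mk'' (Subtype.ext ?_)
  change (op k⁻¹ : Gᵐᵒᵖ) • (K : Set G) = K
  ext x
  rw [Set.mem_smul_set_iff_inv_smul_mem]
  simp [K.mul_mem_cancel_right hk]

/-- By coprimality `N` acts regularly on `N.QuotientDiff`. Transitivity moves a class fixed by `H`
to one fixed by `K`; freeness shows that whatever fixes the first class lies in `H`. -/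
theorem exists_conj_mem_of_isComplement' [Finite G] (N : Subgroup G) [N.Normal]
    [IsMulCommutative N] (hN : Nat.Coprime (Nat.card N) N.index) {H K : Subgroup G}
    (hH : IsComplement' N H) (hK : IsComplement' N K) : ∃ g : G, ∀ k ∈ K, g⁻¹ * k * g ∈ H := by
  obtain ⟨α, hα⟩ := N.exists_le_stabilizer_of_isComplement' hH
  obtain ⟨β, hβ⟩ := N.exists_le_stabilizer_of_isComplement' hK
  obtain ⟨g, hg⟩ := exists_smul_eq hN α β
  refine ⟨g, fun k hk => ?_⟩
  have hfix : ((g : G)⁻¹ * k * g) • α = α := by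
    rw [mul_smul, mul_smul, inv_smul_eq_iff]
    change k • (g • α) = g • α
    rw [hg, hβ k hk]
  obtain ⟨⟨n, h⟩, hnh⟩ := hH.2 ((g : G)⁻¹ * k * g)
  dsimp only at hnh
  have hn : n • α = α := by
    change (n : G) • α = α
    have h' : (h : G) • α = α := hα _ h.2
    rw [← hnh, mul_smul, h'] at hfix
    exact hfix
  rw [eq_one_of_smul_eq_one hN α n hn] at hnh
  rw [← hnh]
  simp

/-- Inside `L = NK`, both `K` and `H ∩ L` are complements of `N`, the latter by Dedekind's law. -/
theorem exists_conj_mem_of_coprime [Finite G] (N : Subgroup G) [N.Normal]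
    [IsMulCommutative N] {H K : Subgroup G} (hH : Nat.Coprime (Nat.card N) (Nat.card H))
    (hK : Nat.Coprime (Nat.card N) (Nat.card K)) (hle : K ≤ N ⊔ H) :
    ∃ g : G, ∀ k ∈ K, g⁻¹ * k * g ∈ H := by
  set L := N ⊔ K with hL
  have hcompl : ∀ M : Subgroup G, Nat.Coprime (Nat.card N) (Nat.card M) → L ≤ N ⊔ M →
      IsComplement' (N.subgroupOf L) (M.subgroupOf L) := by
    intro M hM hLM
    refine isComplement'_of_disjoint_and_mul_eq_univ ?_ ?_
    · rw [disjoint_iff]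
      refine (comap_inf N M L.subtype).symm.trans ?_
      rw [(disjoint_of_coprime_natCard hM).eq_bot]
      exact bot_subgroupOf L
    · refine Set.eq_univ_of_forall fun ⟨x, hx⟩ => ?_
      have hx' : x ∈ ((N ⊔ M : Subgroup G) : Set G) := hLM hx
      rw [normal_mul] at hx'
      obtain ⟨n, hn, m, hm, rfl⟩ := hx'
      have hnL : n ∈ L := (le_sup_left : N ≤ L) hn
      have hmL : m ∈ L := (L.mul_mem_cancel_left hnL).1 hx
      exact ⟨⟨n, hnL⟩, hn, ⟨m, hmL⟩, hm, rfl⟩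
  have hNc : IsMulCommutative (N.subgroupOf L) := inferInstance
  have hKc := hcompl K hK le_rfl
  have hHc := hcompl H hH (sup_le le_sup_left hle)
  have hcop : Nat.Coprime (Nat.card (N.subgroupOf L)) (N.subgroupOf L).index := by
    rw [hKc.symm.index_eq_card, Nat.card_congr (subgroupOfEquivOfLe (le_sup_left : N ≤ L)).toEquiv,
      Nat.card_congr (subgroupOfEquivOfLe (le_sup_right : K ≤ L)).toEquiv]
    exact hK
  obtain ⟨g, hg⟩ := exists_conj_mem_of_isComplement' _ hcop hHc hKc
  exact ⟨g, fun k hk => hg ⟨k, (le_sup_right : K ≤ L) hk⟩ hk⟩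

/-- `|NH : H| = |N : N ∩ H|` divides both `|N|` and `|G : H|`. -/
theorem le_of_coprime_index [Finite G] (N : Subgroup G) [N.Normal] {H : Subgroup G}
    (h : Nat.Coprime (Nat.card N) H.index) : N ≤ H := by
  have h1 : H.relIndex (N ⊔ H) ∣ H.index := relIndex_dvd_index_of_le le_sup_right
  have h2 : H.relIndex (N ⊔ H) ∣ Nat.card N := by
    have e1 := relIndex_mul_relIndex ⊥ H (N ⊔ H) bot_le le_sup_right
    have e2 := relIndex_mul_relIndex ⊥ N (N ⊔ H) bot_le le_sup_left
    have e3 := relIndex_mul_relIndex ⊥ (N ⊓ H) H bot_le inf_le_right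
    rw [relIndex_sup_left, ← e1, ← e3, inf_relIndex_right, mul_right_comm] at e2
    rw [← relIndex_bot_left N, Nat.eq_of_mul_eq_mul_right
      (Nat.pos_of_ne_zero ((N.subgroupOf H).index_ne_zero_of_finite)) e2]
    exact dvd_mul_left _ _
  exact le_sup_left.trans (relIndex_eq_one.1 (Nat.eq_one_of_dvd_coprimes h h2 h1))

end Subgroup

/-! ### Hall's theorem for finite solvable groups -/

theorem exists_normal_elementary_of_isSolvable (G : Type*) [Group G] [Finite G]
    [Group.IsSolvable G] [Nontrivial G] : ∃ (p : ℕ) (N : Subgroup G), p.Prime ∧ N.Normal ∧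
      IsMulCommutative N ∧ N ≠ ⊥ ∧ IsPGroup p N := by
  obtain ⟨A, hAn, hAc, hAb⟩ : ∃ A : Subgroup G, A.Normal ∧ (∀ a ∈ A, ∀ b ∈ A, a * b = b * a) ∧
      A ≠ ⊥ := by
    classical
    have hs := (Group.isSolvable_def G).1 inferInstance
    obtain ⟨n, hn⟩ : ∃ n, Nat.find hs = n + 1 := by
      refine Nat.exists_eq_succ_of_ne_zero fun h0 => ?_
      have := Nat.find_spec hs
      rw [h0, derivedSeries_zero] at this
      exact top_ne_bot this
    -- `A` is the last nontrivial term of the derived series.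
    refine ⟨derivedSeries G n, derivedSeries_normal G n, fun a ha b hb => ?_,
      Nat.find_min hs (by omega)⟩
    have h := Nat.find_spec hs
    rw [hn, derivedSeries_succ] at h
    have := Subgroup.commutator_mem_commutator ha hb
    rw [h, Subgroup.mem_bot] at this
    exact commutatorElement_eq_one_iff_mul_comm.1 this
  have hcard : Nat.card A ≠ 1 := fun h => hAb (A.eq_bot_of_card_eq h)
  obtain ⟨p, hp, hpd⟩ := Nat.exists_prime_and_dvd hcard
  have := Fact.mk hp
  obtain ⟨a, ha⟩ := exists_prime_orderOf_dvd_card' p hpd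
  -- The elements of `A` killed by `p` are permuted by conjugation, and Cauchy's theorem supplies a
  -- nontrivial one.
  let N : Subgroup G :=
    { carrier := {x | x ∈ A ∧ x ^ p = 1}
      one_mem' := ⟨A.one_mem, one_pow p⟩
      mul_mem' := fun {x y} hx hy => ⟨A.mul_mem hx.1 hy.1, by
        rw [Commute.mul_pow (hAc x hx.1 y hy.1), hx.2, hy.2, one_mul]⟩
      inv_mem' := fun {x} hx => ⟨A.inv_mem hx.1, by rw [inv_pow, hx.2, inv_one]⟩ }
  refine ⟨p, N, hp, ⟨fun n hn g => ⟨hAn.conj_mem n hn.1 g, ?_⟩⟩, ⟨⟨fun x y => ?_⟩⟩, fun h => ?_,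
    fun x => ⟨1, ?_⟩⟩
  · rw [conj_pow, hn.2, mul_one, mul_inv_cancel]
  · exact Subtype.ext (hAc x x.2.1 y y.2.1)
  · have haN : (a : G) ∈ N := ⟨a.2, by
      rw [← ha, ← Subgroup.coe_pow, pow_orderOf_eq_one, Subgroup.coe_one]⟩
    rw [h, Subgroup.mem_bot] at haN
    have : a = 1 := Subtype.ext haN
    rw [this, orderOf_one] at ha
    exact hp.ne_one ha.symm
  · rw [pow_one]
    exact Subtype.ext x.2.2

/-- A Hall `π`-subgroup of a finite group. -/
def Subgroup.IsHall {G : Type*} [Group G] (π : Set ℕ) (H : Subgroup G) : Prop :=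
  IsPiNumber π (Nat.card H) ∧ IsPiNumber (primeCompl π) H.index

/-- Hall's theorem for finite solvable groups, existence and dominance. -/
theorem Subgroup.hall_theorem (π : Set ℕ) (G : Type*) [Group G] [Finite G]
    [Group.IsSolvable G] :
    (∃ H : Subgroup G, H.IsHall π) ∧ ∀ H K : Subgroup G, H.IsHall π → IsPiNumber π (Nat.card K) →
      ∃ g : G, ∀ k ∈ K, g⁻¹ * k * g ∈ H := by
  induction hn : Nat.card G using Nat.strong_induction_on generalizing G with
  | _ n ih =>
  rcases subsingleton_or_nontrivial G with hG | hG
  · refine ⟨⟨⊥, ?_, ?_⟩, fun H K _ _ => ⟨1, fun k _ => ?_⟩⟩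
    · rw [Subgroup.card_bot]
      exact AssociationScheme.isPiNumber_one π
    · rw [Subgroup.index_bot, Nat.card_unique]
      exact AssociationScheme.isPiNumber_one _
    · rw [Subsingleton.elim (1⁻¹ * k * 1) 1]
      exact H.one_mem
  obtain ⟨p, N, hp, hNn, hNc, hNb, hNp⟩ := exists_normal_elementary_of_isSolvable G
  have := Fact.mk hp
  obtain ⟨k, hk⟩ := (IsPGroup.iff_card).1 hNp
  have hlt : Nat.card (G ⧸ N) < n := by
    have h1 := N.card_eq_card_quotient_mul_card_subgroup
    have h2 : 1 < Nat.card N := N.one_lt_card_iff_ne_bot.2 hNb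
    have h3 : 0 < Nat.card (G ⧸ N) := Nat.card_pos
    rw [← hn, h1]
    nlinarith
  obtain ⟨⟨Hq, hHq⟩, hdom⟩ := ih _ hlt (G ⧸ N) rfl
  have hsurj : Function.Surjective (QuotientGroup.mk' N) := QuotientGroup.mk'_surjective N
  -- Dominance in `G ⧸ N`, pulled back, only places a conjugate of `K` inside `NH`.
  have key : ∀ H K : Subgroup G, H.IsHall π → IsPiNumber π (Nat.card K) →
      ∃ g : G, ∀ k ∈ K, g⁻¹ * k * g ∈ N ⊔ H := by
    intro H K hH hK
    obtain ⟨g, hg⟩ := hdom (H.map (QuotientGroup.mk' N)) (K.map (QuotientGroup.mk' N))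
      ⟨hH.1.of_dvd (Subgroup.card_map_dvd _ _), hH.2.of_dvd (H.index_map_dvd hsurj)⟩
      (hK.of_dvd (Subgroup.card_map_dvd _ _))
    obtain ⟨g, rfl⟩ := hsurj g
    refine ⟨g, fun k hk => ?_⟩
    have h1 := hg _ (Subgroup.mem_map_of_mem _ hk)
    rw [← map_inv, ← map_mul, ← map_mul, ← Subgroup.mem_comap, Subgroup.comap_map_eq,
      QuotientGroup.ker_mk', sup_comm] at h1
    exact h1
  have hidx : (Hq.comap (QuotientGroup.mk' N)).index = Hq.index :=
    Hq.index_comap_of_surjective hsurj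
  have hNle : N ≤ Hq.comap (QuotientGroup.mk' N) := by
    conv_lhs => rw [← QuotientGroup.ker_mk' N]
    exact Subgroup.ker_le_comap _ _
  have hcard : Nat.card (Hq.comap (QuotientGroup.mk' N)) = Nat.card Hq * Nat.card N := by
    have h1 := (Hq.comap (QuotientGroup.mk' N)).card_mul_index
    have h2 := Hq.card_mul_index
    have h3 := N.card_mul_index
    rw [hidx] at h1
    change _ = Nat.card (G ⧸ N) at h2
    rw [Subgroup.index, ← h2, ← h1] at h3
    have h4 : 0 < Hq.index := Nat.pos_of_ne_zero Subgroup.index_ne_zero_of_finite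
    nlinarith
  by_cases hpπ : p ∈ π
  · have hNπ : IsPiNumber π (Nat.card N) := hk ▸ AssociationScheme.isPiNumber_prime_pow hp hpπ k
    refine ⟨⟨Hq.comap (QuotientGroup.mk' N), ?_, hidx ▸ hHq.2⟩, fun H K hH hK => ?_⟩
    · rw [hcard]
      exact hHq.1.mul hNπ
    · obtain ⟨g, hg⟩ := key H K hH hK
      rw [sup_eq_right.2 (N.le_of_coprime_index (hNπ.coprime hH.2))] at hg
      exact ⟨g, hg⟩
  · have hNπ : IsPiNumber (primeCompl π) (Nat.card N) :=
      hk ▸ AssociationScheme.isPiNumber_prime_pow hp (π := primeCompl π) ⟨hp, hpπ⟩ k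
    refine ⟨?_, fun H K hH hK => ?_⟩
    · set M := Hq.comap (QuotientGroup.mk' N)
      have hcN : Nat.card (N.subgroupOf M) = Nat.card N :=
        Nat.card_congr (Subgroup.subgroupOfEquivOfLe hNle).toEquiv
      have hiN : (N.subgroupOf M).index = Nat.card Hq := by
        have h1 := (N.subgroupOf M).card_mul_index
        rw [hcN, hcard, mul_comm] at h1
        exact Nat.eq_of_mul_eq_mul_right (Nat.card_pos (α := N)) h1
      -- For `p ∉ π` the preimage `M` of `Hq` is too large by the factor `|N|`; the Schur–Zassenhaus
      -- theorem removes it.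
      obtain ⟨C, hC⟩ := Subgroup.exists_right_complement'_of_coprime
        (N := N.subgroupOf M) (by rw [hcN, hiN]; exact (hHq.1.coprime hNπ).symm)
      have hcC : Nat.card (C.map M.subtype) = Nat.card Hq := by
        rw [Subgroup.card_map_of_injective M.subtype_injective, ← hC.symm.index_eq_card, hiN]
      refine ⟨C.map M.subtype, hcC ▸ hHq.1, ?_⟩
      have h1 := (C.map M.subtype).card_mul_index
      have h2 := M.card_mul_index
      rw [hcC] at h1
      rw [hcard, hidx, ← h1, mul_assoc] at h2
      rw [← Nat.eq_of_mul_eq_mul_left (Nat.card_pos (α := Hq)) h2]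
      exact hNπ.mul hHq.2
    · obtain ⟨g, hg⟩ := key H K hH hK
      let K' : Subgroup G := K.map (MulAut.conj g⁻¹).toMonoidHom
      have hK' : Nat.card K' = Nat.card K :=
        Subgroup.card_map_of_injective (MulAut.conj g⁻¹).injective
      obtain ⟨g', hg'⟩ := N.exists_conj_mem_of_coprime (H := H) (K := K')
        (hH.1.coprime hNπ).symm (hK' ▸ (hK.coprime hNπ).symm) (by
          rintro _ ⟨x, hx, rfl⟩
          simpa using hg x hx)
      refine ⟨g * g', fun x hx => ?_⟩
      have := hg' _ (Subgroup.mem_map_of_mem _ hx)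
      simpa [mul_assoc] using this

/-! ### Schemes in terms of points: products, closed subsets, valencies -/

namespace AssociationScheme

variable {X : Type u} [Finite X] {S : AssociationScheme X}

variable (S) in
theorem exists_mem (x y : X) : ∃ s : S.Elem, (x, y) ∈ s.1 := by
  obtain ⟨s, ⟨hs, hm⟩, -⟩ := S.isPartition.2 (x, y)
  exact ⟨⟨s, hs⟩, hm⟩

variable (S) in
/-- The block containing `(x, y)`. -/
noncomputable def rel (x y : X) : S.Elem := Classical.choose (S.exists_mem x y)

theorem mem_rel (x y : X) : (x, y) ∈ (S.rel x y).1 := Classical.choose_spec (S.exists_mem x y)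

theorem mem_iff_rel_eq {s : S.Elem} {x y : X} : (x, y) ∈ s.1 ↔ S.rel x y = s := by
  refine ⟨fun h => Subtype.ext ?_, fun h => h ▸ mem_rel x y⟩
  obtain ⟨t, -, ht⟩ := S.isPartition.2 (x, y)
  exact (ht _ ⟨(S.rel x y).2, mem_rel x y⟩).trans (ht _ ⟨s.2, h⟩).symm

theorem exists_rel_eq (s : S.Elem) : ∃ x y, S.rel x y = s := by
  obtain ⟨⟨x, y⟩, h⟩ : s.1.Nonempty :=
    Set.nonempty_iff_ne_empty.2 fun h => S.isPartition.1 (h ▸ s.2)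
  exact ⟨x, y, mem_iff_rel_eq.1 h⟩

theorem nonempty_points (S : AssociationScheme X) : Nonempty X := by
  obtain ⟨x, -, -⟩ := exists_rel_eq S.one
  exact ⟨x⟩

theorem rel_eq_one_iff {x y : X} : S.rel x y = S.one ↔ x = y := by
  rw [← mem_iff_rel_eq]
  rfl

@[simp] theorem rel_self (x : X) : S.rel x x = S.one := rel_eq_one_iff.2 rfl

theorem star_rel (x y : X) : S.star (S.rel x y) = S.rel y x :=
  (mem_iff_rel_eq.1 (show (y, x) ∈ (S.star (S.rel x y)).1 from mem_rel x y)).symm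

@[simp] theorem star_star (s : S.Elem) : S.star (S.star s) = s := rfl

theorem rel_eq_star_iff {s : S.Elem} {x y : X} : S.rel x y = S.star s ↔ S.rel y x = s := by
  rw [← star_rel y x]
  exact ⟨fun h => by simpa using congrArg S.star h, fun h => h ▸ rfl⟩

theorem ncard_rel (p q : S.Elem) (x z : X) :
    {w | S.rel x w = p ∧ S.rel w z = q}.ncard = S.structConst p q (S.rel x z) := by
  rw [← S.structConst_spec p q _ (mem_rel x z)]
  simp only [mem_iff_rel_eq]

theorem structConst_rel_ne_zero {p q : S.Elem} {x z : X} :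
    S.structConst p q (S.rel x z) ≠ 0 ↔ ∃ w, S.rel x w = p ∧ S.rel w z = q := by
  rw [← ncard_rel, Ne, Set.ncard_eq_zero (Set.toFinite _), ← Ne, ← Set.nonempty_iff_ne_empty]
  rfl

/-- Complex products become paths through points, so that later arguments can chase points instead
of structure constants. -/
theorem rel_mem_complexMul {P Q : Set S.Elem} {x z : X} :
    S.rel x z ∈ S.complexMul P Q ↔ ∃ w, S.rel x w ∈ P ∧ S.rel w z ∈ Q := by
  constructor
  · rintro ⟨p, hp, q, hq, h⟩
    obtain ⟨w, rfl, rfl⟩ := structConst_rel_ne_zero.1 h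
    exact ⟨w, hp, hq⟩
  · rintro ⟨w, hp, hq⟩
    exact ⟨_, hp, _, hq, structConst_rel_ne_zero.2 ⟨w, rfl, rfl⟩⟩

/-- By regularity, membership of `1` in `ss*` witnessed at one point is witnessed at every point. -/
theorem exists_rel_eq_right (x : X) (s : S.Elem) : ∃ y, S.rel x y = s := by
  obtain ⟨a, b, rfl⟩ := exists_rel_eq s
  have : S.rel a a ∈ S.complexMul {S.rel a b} {S.rel b a} :=
    rel_mem_complexMul.2 ⟨b, rfl, rfl⟩
  rw [rel_self, ← rel_self x] at this
  obtain ⟨w, hw, -⟩ := rel_mem_complexMul.1 this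
  exact ⟨w, hw⟩

theorem exists_rel_eq_left (y : X) (s : S.Elem) : ∃ x, S.rel x y = s := by
  obtain ⟨x, hx⟩ := exists_rel_eq_right y (S.star s)
  exact ⟨x, rel_eq_star_iff.1 hx⟩

noncomputable instance : Mul (Set S.Elem) := ⟨S.complexMul⟩

theorem rel_mem_mul {P Q : Set S.Elem} {x z : X} :
    S.rel x z ∈ P * Q ↔ ∃ w, S.rel x w ∈ P ∧ S.rel w z ∈ Q := rel_mem_complexMul

theorem conj_eq (s : S.Elem) (T : Set S.Elem) : S.conj s T = {S.star s} * T * {s} := rfl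

theorem rel_mem_conj {s : S.Elem} {T : Set S.Elem} {x y : X} :
    S.rel x y ∈ S.conj s T ↔ ∃ x' y', S.rel x' x = s ∧ S.rel y' y = s ∧ S.rel x' y' ∈ T := by
  simp only [conj_eq, rel_mem_mul, Set.mem_singleton_iff, rel_eq_star_iff]
  constructor
  · rintro ⟨y', ⟨x', h1, h2⟩, h3⟩
    exact ⟨x', y', h1, h3, h2⟩
  · rintro ⟨x', y', h1, h3, h2⟩
    exact ⟨y', ⟨x', h1, h2⟩, h3⟩

namespace IsClosedSubset

variable {T : Set S.Elem}

theorem rel_mem (hT : S.IsClosedSubset T) {x y z : X} (h1 : S.rel x y ∈ T)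
    (h2 : S.rel x z ∈ T) : S.rel y z ∈ T :=
  hT.2 _ h1 _ h2 (rel_mem_complexMul.2 ⟨x, (star_rel x y).symm, rfl⟩)

theorem one_mem (hT : S.IsClosedSubset T) : S.one ∈ T := by
  obtain ⟨t, ht⟩ := hT.1
  obtain ⟨x, y, rfl⟩ := exists_rel_eq t
  rw [← rel_self y]
  exact hT.rel_mem ht ht

theorem symm (hT : S.IsClosedSubset T) {x y : X} (h : S.rel x y ∈ T) : S.rel y x ∈ T :=
  hT.rel_mem h (by simpa using hT.one_mem)

theorem trans (hT : S.IsClosedSubset T) {x y z : X} (h1 : S.rel x y ∈ T)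
    (h2 : S.rel y z ∈ T) : S.rel x z ∈ T := hT.rel_mem (hT.symm h1) h2

theorem star_mem (hT : S.IsClosedSubset T) {s : S.Elem} (h : s ∈ T) : S.star s ∈ T := by
  obtain ⟨x, y, rfl⟩ := exists_rel_eq s
  rw [star_rel]
  exact hT.symm h

theorem of_rel (h1 : ∃ x, S.rel x x ∈ T)
    (h : ∀ x y z, S.rel x y ∈ T → S.rel x z ∈ T → S.rel y z ∈ T) : S.IsClosedSubset T := by
  refine ⟨⟨_, h1.choose_spec⟩, fun p hp q hq s hs => ?_⟩
  obtain ⟨y, z, rfl⟩ := exists_rel_eq s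
  obtain ⟨x, hx, rfl⟩ := rel_mem_complexMul.1 hs
  rw [Set.mem_singleton_iff, rel_eq_star_iff] at hx
  exact h x y z (hx ▸ hp) hq

variable (S) in
theorem univ : S.IsClosedSubset Set.univ := ⟨⟨S.one, trivial⟩, fun _ _ _ _ => Set.subset_univ _⟩

theorem inter {U : Set S.Elem} (hT : S.IsClosedSubset T) (hU : S.IsClosedSubset U) :
    S.IsClosedSubset (T ∩ U) :=
  ⟨⟨S.one, hT.one_mem, hU.one_mem⟩, fun p hp q hq =>
    Set.subset_inter (hT.2 p hp.1 q hq.1) (hU.2 p hp.2 q hq.2)⟩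

end IsClosedSubset

theorem valency_eq_ncard (s : S.Elem) (x : X) : S.valency s = {y | S.rel x y = s}.ncard := by
  rw [valency, ← rel_self x, ← ncard_rel]
  simp only [rel_eq_star_iff, and_self]

theorem setValency_eq_ncard (T : Set S.Elem) (x : X) :
    S.setValency T = {y | S.rel x y ∈ T}.ncard := by
  classical
  have := Fintype.ofFinite X
  have := Fintype.ofFinite S.Elem
  rw [setValency, finsum_mem_eq_finite_toFinset_sum _ (Set.toFinite T),
    Set.ncard_eq_toFinset_card' {y | S.rel x y ∈ T},
    Finset.card_eq_sum_card_fiberwise (f := S.rel x) (t := (Set.toFinite T).toFinset)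
      (fun y hy => by simpa using hy)]
  refine Finset.sum_congr rfl fun s hs => ?_
  rw [valency_eq_ncard s x, Set.ncard_eq_toFinset_card']
  congr 1
  ext y
  have : s ∈ T := by simpa using hs
  simp only [Set.mem_toFinset, Set.mem_ofPred_eq, Finset.mem_filter]
  exact ⟨fun h => ⟨h ▸ this, h⟩, fun h => h.2⟩

theorem eq_of_subset_of_setValency_le {T U : Set S.Elem} (h : T ⊆ U)
    (hle : S.setValency U ≤ S.setValency T) : T = U := by
  obtain ⟨x⟩ := S.nonempty_points
  rw [setValency_eq_ncard T x, setValency_eq_ncard U x] at hle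
  have hsub : {y | S.rel x y ∈ T} ⊆ {y | S.rel x y ∈ U} := fun y hy => h hy
  have h1 := Set.eq_of_subset_of_ncard_le hsub hle (Set.toFinite _)
  refine h.antisymm fun u hu => ?_
  obtain ⟨y, rfl⟩ := exists_rel_eq_right x u
  have : y ∈ {y | S.rel x y ∈ U} := hu
  rwa [← h1] at this

theorem setValency_pos {T : Set S.Elem} (h : T.Nonempty) : 0 < S.setValency T := by
  obtain ⟨x⟩ := S.nonempty_points
  obtain ⟨t, ht⟩ := h
  obtain ⟨y, rfl⟩ := exists_rel_eq_right x t
  rw [setValency_eq_ncard T x, Set.ncard_pos (Set.toFinite _)]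
  exact ⟨y, ht⟩

theorem setValency_singleton (s : S.Elem) : S.setValency {s} = S.valency s := by
  simp [setValency]

theorem setValency_one : S.setValency {S.one} = 1 := by
  obtain ⟨x⟩ := S.nonempty_points
  rw [setValency_eq_ncard _ x]
  simp [rel_eq_one_iff]

end AssociationScheme

/-! ### Indices, double cosets and the strongly normal `π`-subset -/

namespace AssociationScheme

variable {X : Type u} [Finite X] {S : AssociationScheme X}

theorem _root_.Set.ncard_eq_ncard_image_mul {α β : Type*} [Finite α] (s : Set α) (f : α → β)
    (c : ℕ) (h : ∀ y ∈ s, {z | z ∈ s ∧ f z = f y}.ncard = c) :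
    s.ncard = (f '' s).ncard * c := by
  classical
  have := Fintype.ofFinite α
  rw [Set.ncard_eq_toFinset_card' s, Finset.card_eq_sum_card_image f,
    Finset.sum_const_nat (m := c), ← Set.ncard_coe_finset, Finset.coe_image, Set.coe_toFinset]
  intro b hb
  obtain ⟨y, hy, rfl⟩ := Finset.mem_image.1 hb
  rw [← h y (by simpa using hy), Set.ncard_eq_toFinset_card']
  congr 1
  ext z
  simp

/-- The points `U`-related to `x` split into `T`-classes, all of size `n_T`. -/
theorem IsClosedSubset.setValency_dvd {T U : Set S.Elem} (hT : S.IsClosedSubset T)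
    (hU : S.IsClosedSubset U) (h : T ⊆ U) : S.setValency T ∣ S.setValency U := by
  obtain ⟨x⟩ := S.nonempty_points
  rw [setValency_eq_ncard U x, Set.ncard_eq_ncard_image_mul _
    (fun y => {z | S.rel y z ∈ T}) (S.setValency T)]
  · exact dvd_mul_left _ _
  · intro y hy
    rw [setValency_eq_ncard T y]
    congr 1
    ext z
    constructor
    · rintro ⟨-, hz⟩
      have : z ∈ {w | S.rel z w ∈ T} := by simpa using hT.one_mem
      rwa [hz] at this
    · intro hz
      refine ⟨hU.trans hy (h hz), ?_⟩
      ext w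
      exact ⟨fun hw => hT.trans hz hw, fun hw => hT.rel_mem hz hw⟩

theorem IsClosedSubset.setValency_eq_mul_index {T U : Set S.Elem} (hT : S.IsClosedSubset T)
    (hU : S.IsClosedSubset U) (h : T ⊆ U) : S.setValency U = S.setValency T * S.index T U :=
  (Nat.mul_div_cancel' (hT.setValency_dvd hU h)).symm

/-- Closure of the adjacency algebra under multiplication, stated for coefficient functions. -/
theorem exists_sum_rel_eq [Fintype X] (F G : S.Elem → ℕ) :
    ∃ H : S.Elem → ℕ, ∀ x y, ∑ w, F (S.rel x w) * G (S.rel w y) = H (S.rel x y) := by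
  classical
  have := Fintype.ofFinite S.Elem
  refine ⟨fun r => ∑ p, ∑ q, F p * G q * S.structConst p q r, fun x y => ?_⟩
  have h (p q : S.Elem) : S.structConst p q (S.rel x y) =
      ∑ w, if S.rel x w = p ∧ S.rel w y = q then 1 else 0 := by
    rw [← ncard_rel, Set.ncard_eq_toFinset_card', Finset.sum_boole]
    simp
  simp only [h, Finset.mul_sum]
  rw [Finset.sum_congr rfl fun p _ => Finset.sum_comm, Finset.sum_comm]
  refine Finset.sum_congr rfl fun w _ => ?_
  rw [Finset.sum_eq_single (S.rel x w), Finset.sum_eq_single (S.rel w y)]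
  · simp
  · intro q _ hq
    simp [hq.symm]
  · simp
  · intro p _ hp
    refine Finset.sum_eq_zero fun q _ => ?_
    simp [hp.symm]
  · simp

theorem rel_mem_double {P : Set S.Elem} {u : S.Elem} {x y : X} :
    S.rel x y ∈ P * {u} * P ↔
      ∃ x' y', S.rel x x' ∈ P ∧ S.rel x' y' = u ∧ S.rel y' y ∈ P := by
  simp only [rel_mem_mul, Set.mem_singleton_iff]
  constructor
  · rintro ⟨y', ⟨x', h1, h2⟩, h3⟩
    exact ⟨x', y', h1, h2, h3⟩
  · rintro ⟨x', y', h1, h2, h3⟩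
    exact ⟨y', ⟨x', h1, h2⟩, h3⟩

/-- Any two pairs in the same double coset are linked by a pair with the same relation. -/
theorem IsClosedSubset.exists_rel_of_mem_double {P : Set S.Elem} (hP : S.IsClosedSubset P)
    {u : S.Elem} {x y x₂ y₂ : X} (h : S.rel x y ∈ P * {u} * P) (h₂ : S.rel x₂ y₂ ∈ P * {u} * P) :
    ∃ a c, S.rel x₂ a ∈ P ∧ S.rel a c = S.rel x y ∧ S.rel c y₂ ∈ P := by
  obtain ⟨a, b, hxa, hab, hby⟩ := rel_mem_double.1 h
  obtain ⟨a₂, b₂, hxa₂, hab₂, hby₂⟩ := rel_mem_double.1 h₂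
  have : S.rel a b ∈ P * {S.rel x y} * P :=
    rel_mem_double.2 ⟨x, y, hP.symm hxa, rfl, hP.symm hby⟩
  rw [hab, ← hab₂] at this
  obtain ⟨c, d, h1, h2, h3⟩ := rel_mem_double.1 this
  exact ⟨c, d, hP.trans hxa₂ h1, h2, hP.trans h3 hby₂⟩

theorem IsClosedSubset.double_trans {P : Set S.Elem} (hP : S.IsClosedSubset P)
    {u : S.Elem} {x x' y' y : X} (h1 : S.rel x x' ∈ P) (h2 : S.rel x' y' ∈ P * {u} * P)
    (h3 : S.rel y' y ∈ P) : S.rel x y ∈ P * {u} * P := by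
  obtain ⟨a, b, hxa, hab, hby⟩ := rel_mem_double.1 h2
  exact rel_mem_double.2 ⟨a, b, hP.trans h1 hxa, hab, hP.trans hby h3⟩

/-- Paths from a fixed point with steps in `P`, `u`, `P` number `n_P n_u n_P`. They end exactly at
the points in relation `PuP` to the start, and equally many end at each of these. -/
theorem IsClosedSubset.setValency_double_dvd {P : Set S.Elem} (hP : S.IsClosedSubset P)
    (u : S.Elem) :
    S.setValency (P * {u} * P) ∣ S.setValency P * S.valency u * S.setValency P := by
  classical
  have := Fintype.ofFinite X
  let i : Set S.Elem → S.Elem → ℕ := fun Q s => if s ∈ Q then 1 else 0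
  have hi (Q : Set S.Elem) (x : X) : ∑ y, i Q (S.rel x y) = S.setValency Q := by
    rw [setValency_eq_ncard Q x, Set.ncard_eq_toFinset_card', Finset.sum_boole]
    simp
  -- `K (S.rel x y)` is the number of such paths from `x` to `y`; it does not change when either
  -- endpoint moves within its `P`-class.
  obtain ⟨H, hH⟩ := exists_sum_rel_eq (i P) (i {u})
  obtain ⟨K, hK⟩ := exists_sum_rel_eq H (i P)
  have hKeq (x y : X) : K (S.rel x y) = ∑ v, (∑ w, i P (S.rel x w) * i {u} (S.rel w v)) *
      i P (S.rel v y) := by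
    rw [← hK]
    exact Finset.sum_congr rfl fun v _ => by rw [hH]
  have hKl {x x' : X} (y : X) (h : S.rel x x' ∈ P) : K (S.rel x y) = K (S.rel x' y) := by
    rw [hKeq, hKeq]
    have (w : X) : i P (S.rel x w) = i P (S.rel x' w) :=
      if_congr ⟨fun hw => hP.rel_mem h hw, fun hw => hP.trans h hw⟩ rfl rfl
    simp only [this]
  have hKr (x : X) {y y' : X} (h : S.rel y' y ∈ P) : K (S.rel x y) = K (S.rel x y') := by
    rw [hKeq, hKeq]
    have (w : X) : i P (S.rel w y) = i P (S.rel w y') :=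
      if_congr ⟨fun hw => hP.trans hw (hP.symm h), fun hw => hP.trans hw h⟩ rfl rfl
    simp only [this]
  obtain ⟨x, y, hxy⟩ := exists_rel_eq u
  have hmem : S.rel x y ∈ P * {u} * P := rel_mem_double.2
    ⟨x, y, by simpa using hP.one_mem, hxy, by simpa using hP.one_mem⟩
  have hconst (z : X) : K (S.rel x z) = K u * i (P * {u} * P) (S.rel x z) := by
    by_cases hz : S.rel x z ∈ P * {u} * P
    · obtain ⟨a, c, h1, h2, h3⟩ := hP.exists_rel_of_mem_double hmem hz
      simp only [i, if_pos hz, mul_one]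
      rw [hKl z h1, hKr a h3, h2, hxy]
    · simp only [i, if_neg hz, mul_zero]
      rw [hKeq]
      refine Finset.sum_eq_zero fun v _ => ?_
      by_contra hne
      obtain ⟨h1, h2⟩ := Nat.mul_ne_zero_iff.1 hne
      obtain ⟨w, -, hw⟩ := Finset.exists_ne_zero_of_sum_ne_zero h1
      obtain ⟨h3, h4⟩ := Nat.mul_ne_zero_iff.1 hw
      exact hz (rel_mem_double.2 ⟨w, v, (by simpa [i] using h3), (by simpa [i] using h4),
        (by simpa [i] using h2)⟩)
  have hsum : ∑ z, K (S.rel x z) = S.setValency P * S.valency u * S.setValency P := by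
    simp only [hKeq]
    rw [Finset.sum_comm]
    simp only [← Finset.mul_sum, hi]
    rw [← Finset.sum_mul, Finset.sum_comm]
    simp only [← Finset.mul_sum, hi]
    rw [← Finset.sum_mul, hi, setValency_singleton]
  rw [← hsum, Finset.sum_congr rfl fun z _ => hconst z, ← Finset.mul_sum, hi]
  exact dvd_mul_left _ _

theorem IsStronglyNormalIn.rel_mem {P T : Set S.Elem} (h : S.IsStronglyNormalIn P T) {g : S.Elem}
    (hg : g ∈ T) {x y x' y' : X} (hx : S.rel x x' = g) (hy : S.rel y y' = g)
    (hxy : S.rel x y ∈ P) : S.rel x' y' ∈ P :=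
  h.2 g hg (rel_mem_conj.2 ⟨x, y, hx, hy, hxy⟩)

/-- A strongly normal closed `π`-subset of `T` that has the largest possible valency is strongly
normal in every closed `π`-valenced `U` in which `T` is strongly normal. -/
theorem IsStronglyNormalIn.of_maximal {π : Set ℕ} {P T U : Set S.Elem}
    (hP : S.IsClosedSubset P) (hT : S.IsClosedSubset T) (hU : S.IsClosedSubset U)
    (hPT : S.IsStronglyNormalIn P T) (hTU : S.IsStronglyNormalIn T U)
    (hπ : IsPiNumber π (S.setValency P)) (hval : S.IsPiValencedSubset π U)
    (hmax : ∀ Q, S.IsClosedSubset Q → S.IsStronglyNormalIn Q T →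
      IsPiNumber π (S.setValency Q) → S.setValency Q ≤ S.setValency P) :
    S.IsStronglyNormalIn P U := by
  refine ⟨hPT.1.trans hTU.1, fun u hu => ?_⟩
  set D : Set S.Elem := P * {u} * P with hD
  have hDe (y : X) : ∃ x, S.rel x y ∈ D := by
    obtain ⟨x, hx⟩ := exists_rel_eq_left y u
    exact ⟨x, rel_mem_double.2 ⟨x, y, by simpa using hP.one_mem, hx, by simpa using hP.one_mem⟩⟩
  let B : Set S.Elem := {s | S.star s ∈ D} * D
  have hB {y z : X} : S.rel y z ∈ B ↔ ∃ x, S.rel x y ∈ D ∧ S.rel x z ∈ D := by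
    simp only [B, rel_mem_mul, Set.mem_ofPred_eq, star_rel]
  have hBT {y z : X} (h : S.rel y z ∈ B) : S.rel y z ∈ T := by
    obtain ⟨x, h1, h2⟩ := hB.1 h
    obtain ⟨a, y₁, hxa, hay, hy⟩ := rel_mem_double.1 h1
    obtain ⟨b, z₁, hxb, hbz, hz⟩ := rel_mem_double.1 h2
    have h3 : S.rel y₁ z₁ ∈ T := hTU.rel_mem hu hay hbz (hPT.1 (hP.rel_mem hxa hxb))
    exact hT.rel_mem (hPT.1 hy) (hT.trans h3 (hPT.1 hz))
  -- The triangle `x', y, z` witnessing membership in `B` is copied to `a, c, b` with `a` near `x`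
  -- and `c` near `y` modulo `P`. Strong normality of `P` in `T`, applied to the common relation of
  -- `(c, b)` and `(y, z)`, puts `b` near `z`.
  have hDB {x y z : X} (h : S.rel y z ∈ B) (hxy : S.rel x y ∈ D) : S.rel x z ∈ D := by
    obtain ⟨x', h1, h2⟩ := hB.1 h
    obtain ⟨a, c, hxa, hac, hcy⟩ := hP.exists_rel_of_mem_double h1 hxy
    obtain ⟨b, hb, hb'⟩ : ∃ b, S.rel a b = S.rel x' z ∧ S.rel b c = S.rel z y := by
      have := rel_mem_mul.2 ⟨z, Set.mem_singleton (S.rel x' z), Set.mem_singleton (S.rel z y)⟩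
      rw [← hac] at this
      exact rel_mem_mul.1 this
    have hcb : S.rel c b = S.rel y z := by rw [← star_rel b c, hb', star_rel]
    exact hP.double_trans hxa (hb ▸ h2) (hPT.rel_mem (hBT h) hcb rfl hcy)
  have hBc : S.IsClosedSubset B := by
    refine IsClosedSubset.of_rel ?_ fun x y z h1 h2 => ?_
    · obtain ⟨y⟩ := S.nonempty_points
      obtain ⟨x, hx⟩ := hDe y
      exact ⟨y, hB.2 ⟨x, hx, hx⟩⟩
    · obtain ⟨w, hw⟩ := hDe x
      exact hB.2 ⟨w, hDB h1 hw, hDB h2 hw⟩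
  have hPB : P ⊆ B := by
    intro p hp
    obtain ⟨y, z, rfl⟩ := exists_rel_eq p
    obtain ⟨x, hx⟩ := hDe y
    exact hB.2 ⟨x, hx, hP.double_trans (by simpa using hP.one_mem) hx hp⟩
  have hBn : S.IsStronglyNormalIn B T := by
    refine ⟨fun b hb => ?_, fun g hg b hb => ?_⟩
    · obtain ⟨y, z, rfl⟩ := exists_rel_eq b
      exact hBT hb
    obtain ⟨y, z, rfl⟩ := exists_rel_eq b
    obtain ⟨y', z', hy, hz, hyz⟩ := rel_mem_conj.1 hb
    obtain ⟨x, hx⟩ := hDe y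
    obtain ⟨a, ha⟩ := hDe y'
    have haz := hDB hyz ha
    -- The path `a, x, y, y'` is to be copied as `c, p, r, d`. Strong normality of `P` in `T`
    -- carries `P`-closeness from `a, c` to `x, p` and from `d, z'` to `r, z`, which shows `S.rel x
    -- z ∈ D`.
    obtain ⟨c, d, h1, h2, h3⟩ := hP.exists_rel_of_mem_double ha haz
    -- Strong normality of `T` in `U`, used for `u*`: the `T`-related points `y'` and `y` are traced
    -- back along `u`.
    have hxa : S.rel a x ∈ T := by
      obtain ⟨a₁, y₁', k1, k2, k3⟩ := rel_mem_double.1 ha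
      obtain ⟨x₁, y₁, m1, m2, m3⟩ := rel_mem_double.1 hx
      have hyT : S.rel y₁' y₁ ∈ T :=
        hT.trans (hPT.1 k3) (hT.trans (hy ▸ hg) (hT.symm (hPT.1 m3)))
      have := hTU.rel_mem (hU.star_mem hu) (rel_eq_star_iff.2 k2) (rel_eq_star_iff.2 m2) hyT
      exact hT.trans (hPT.1 k1) (hT.trans this (hT.symm (hPT.1 m1)))
    obtain ⟨p, hp, hp'⟩ : ∃ p, S.rel c p = S.rel a x ∧ S.rel p d = S.rel x y' := by
      have := rel_mem_mul.2 ⟨x, Set.mem_singleton (S.rel a x), Set.mem_singleton (S.rel x y')⟩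
      rw [← h2] at this
      exact rel_mem_mul.1 this
    have hxp : S.rel x p ∈ P := hPT.rel_mem hxa rfl hp h1
    obtain ⟨r, hr, hr'⟩ : ∃ r, S.rel p r = S.rel x y ∧ S.rel r d = S.rel y y' := by
      have := rel_mem_mul.2 ⟨y, Set.mem_singleton (S.rel x y), Set.mem_singleton (S.rel y y')⟩
      rw [← hp'] at this
      exact rel_mem_mul.1 this
    have hdr : S.rel d r = g := by rw [← star_rel r d, hr', star_rel, hy]
    have hrz : S.rel r z ∈ P := hPT.rel_mem hg hdr hz h3
    exact hB.2 ⟨x, hx, hP.double_trans hxp (hr ▸ hx) hrz⟩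
  -- If `S.rel x y ∈ D`, the points `B`-related to `y` are those `D`-related to `x`.
  have hBD : S.setValency B = S.setValency D := by
    obtain ⟨y⟩ := S.nonempty_points
    obtain ⟨x, hx⟩ := hDe y
    rw [setValency_eq_ncard B y, setValency_eq_ncard D x]
    congr 1
    ext z
    exact ⟨fun h => hDB h hx, fun h => hB.2 ⟨x, hx, h⟩⟩
  have hBπ : IsPiNumber π (S.setValency B) :=
    hBD ▸ ((hπ.mul (hval u hu)).mul hπ).of_dvd (hP.setValency_double_dvd u)
  have hPeq : P = B := eq_of_subset_of_setValency_le hPB (hmax B hBc hBn hBπ)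
  intro s hs
  obtain ⟨x, y, rfl⟩ := exists_rel_eq s
  obtain ⟨x', y', hx, hy, hxy⟩ := rel_mem_conj.1 hs
  rw [hPeq]
  exact hB.2 ⟨x', rel_mem_double.2 ⟨x', x, by simpa using hP.one_mem, hx,
      by simpa using hP.one_mem⟩,
    rel_mem_double.2 ⟨y', y, hxy, hy,
      by simpa using hP.one_mem⟩⟩

/-- A `π`-valenced scheme with a subnormal series for strong normality has a closed subset whose
valency is a `π`-number and whose quotient is thin. -/
theorem exists_isStronglyNormalIn_isPiNumber {π : Set ℕ} (hval : S.IsPiValenced π) {n : ℕ}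
    {T : ℕ → Set S.Elem} (hc : ∀ i ≤ n, S.IsClosedSubset (T i)) (h0 : T 0 = {S.one})
    (hT : ∀ i < n, S.IsStronglyNormalIn (T i) (T (i + 1))) :
    ∃ P, S.IsClosedSubset P ∧ S.IsStronglyNormalIn P (T n) ∧ IsPiNumber π (S.setValency P) := by
  suffices h : ∀ i ≤ n, ∃ P, S.IsClosedSubset P ∧ S.IsStronglyNormalIn P (T i) ∧
      IsPiNumber π (S.setValency P) from h n le_rfl
  intro i
  induction i with
  | zero =>
    intro _
    have h := hc 0 (Nat.zero_le n)
    refine ⟨T 0, h, ⟨subset_rfl, fun t ht s hs => ?_⟩, ?_⟩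
    · obtain ⟨x, y, rfl⟩ := exists_rel_eq s
      obtain ⟨x', y', h1, h2, h3⟩ := rel_mem_conj.1 hs
      exact h.rel_mem (h1 ▸ ht) (h.trans h3 (h2 ▸ ht))
    · rw [h0, setValency_one]
      exact isPiNumber_one π
  | succ i ih =>
    intro hi
    let A : Set (Set S.Elem) := {P | S.IsClosedSubset P ∧ S.IsStronglyNormalIn P (T i) ∧
      IsPiNumber π (S.setValency P)}
    obtain ⟨P, hP, hmax⟩ := (Set.toFinite A).exists_maximalFor S.setValency A (ih (by omega))
    refine ⟨P, hP.1, hP.2.1.of_maximal hP.1 (hc i (by omega)) (hc (i + 1) hi) (hT i (by omega))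
      hP.2.2 (fun t _ => hval t trivial) fun Q h1 h2 h3 => ?_, hP.2.2⟩
    exact (le_total (S.setValency Q) (S.setValency P)).elim id fun hle => hmax ⟨h1, h2, h3⟩ hle

end AssociationScheme

/-! ### Group-theoretic preliminaries for the quotient -/

/-- Index 1 is allowed because consecutive members of a series of `S` can have the same image in the
quotient group. -/
theorem isSolvable_of_relIndex_chain {G : Type*} [Group G] {n : ℕ} (K : ℕ → Subgroup G)
    (h0 : K 0 = ⊥) (hn : K n = ⊤) (hle : ∀ i < n, K i ≤ K (i + 1))
    (hnorm : ∀ i < n, ((K i).subgroupOf (K (i + 1))).Normal)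
    (hidx : ∀ i < n, (K i).relIndex (K (i + 1)) = 1 ∨ ((K i).relIndex (K (i + 1))).Prime) :
    Group.IsSolvable G := by
  have h : ∀ i ≤ n, Group.IsSolvable (K i) := by
    intro i
    induction i with
    | zero =>
      intro _
      rw [h0]
      infer_instance
    | succ i ih =>
      intro hi
      have := hnorm i hi
      have := ih (by omega)
      have h1 : Group.IsSolvable (K (i + 1) ⧸ (K i).subgroupOf (K (i + 1))) := by
        rcases hidx i hi with h | h
        · have := (Nat.card_eq_one_iff_unique.1 h).1
          infer_instance
        · have := Fact.mk h
          have := isCyclic_of_prime_card (α := K (i + 1) ⧸ (K i).subgroupOf (K (i + 1)))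
            (p := (K i).relIndex (K (i + 1))) rfl
          let := IsCyclic.commGroup (α := K (i + 1) ⧸ (K i).subgroupOf (K (i + 1)))
          exact Group.isSolvable_of_comm fun a b => mul_comm a b
      have h2 : Group.IsSolvable ((K i).subgroupOf (K (i + 1))) :=
        Group.isSolvable_of_isSolvable_injective
          (Subgroup.subgroupOfEquivOfLe (hle i hi)).injective
            (f := (Subgroup.subgroupOfEquivOfLe (hle i hi)).toMonoidHom)
      exact (Group.isSolvable_iff_subgroup_quotient _).2 ⟨h2, h1⟩
  have := h n le_rfl
  rw [hn] at this
  exact Group.isSolvable_of_surjective (f := (⊤ : Subgroup G).subtype) fun g => ⟨⟨g, trivial⟩, rfl⟩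

namespace Subgroup.IsHall

variable {G : Type*} [Group G] {π : Set ℕ} {H K : Subgroup G}

theorem map_conj (hH : H.IsHall π) (g : G) : (H.map (MulAut.conj g).toMonoidHom).IsHall π := by
  refine ⟨?_, ?_⟩
  · rw [Subgroup.card_map_of_injective (MulAut.conj g).injective]
    exact hH.1
  · rw [MulEquiv.toMonoidHom_eq_coe, Subgroup.index_map_equiv]
    exact hH.2

theorem eq_of_le (hH : H.IsHall π) (hK : K.IsHall π) (hle : H ≤ K) : H = K :=
  hle.antisymm (relIndex_eq_one.1 (Nat.eq_one_of_dvd_coprimes (hK.1.coprime hH.2)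
    (H.relIndex_dvd_card K) ⟨_, (relIndex_mul_index hle).symm⟩))

end Subgroup.IsHall

/-! ### The quotient group and the correspondence of closed subsets with subgroups -/

namespace AssociationScheme

variable {X : Type u} [Finite X] {S : AssociationScheme X}

/-- A morphism from a scheme to a group, regarded as a thin scheme. -/
def IsGroupMorphism {G : Type*} [Group G] (φ : S.Elem → G) : Prop :=
  ∀ x y z, φ (S.rel x z) = φ (S.rel x y) * φ (S.rel y z)

/-- The quotient of a scheme by a strongly normal closed subset is a group. -/
theorem exists_isGroupMorphism {P : Set S.Elem} (hP : S.IsClosedSubset P)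
    (hn : S.IsStronglyNormalIn P Set.univ) : ∃ (G : Type u) (_ : Group G) (_ : Finite G)
      (φ : S.Elem → G), IsGroupMorphism φ ∧ Function.Surjective φ ∧ ∀ s, φ s = 1 ↔ s ∈ P := by
  let R : Setoid X := ⟨fun x y => S.rel x y ∈ P, fun x => by simpa using hP.one_mem,
    fun h => hP.symm h, fun h1 h2 => hP.trans h1 h2⟩
  choose f hf using fun (s : S.Elem) y => exists_rel_eq_left y s
  have hcongr (s : S.Elem) {x y x' y' : X} (h : S.rel x y = s) (h' : S.rel x' y' = s)
      (hy : S.rel y y' ∈ P) : S.rel x x' ∈ P :=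
    hn.rel_mem (g := S.star s) trivial (rel_eq_star_iff.2 h) (rel_eq_star_iff.2 h') hy
  -- The group is realised by permutations of the `P`-classes: `s` sends the class of `y` to that of
  -- any `x` with `S.rel x y = s`. Strong normality makes this independent of the choices, and
  -- sending second point to first makes `σ` multiplicative in the right order.
  let F (s : S.Elem) : Quotient R → Quotient R :=
    Quotient.map (f s) fun y y' h => hcongr s (hf s y) (hf s y') h
  have hF {s : S.Elem} {x y : X} (h : S.rel x y = s) : F s (Quotient.mk R y) = Quotient.mk R x :=
    Quotient.sound (hcongr s (hf s y) h (by simpa using hP.one_mem))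
  have hinv (s : S.Elem) (q : Quotient R) : F (S.star s) (F s q) = q := by
    induction q using Quotient.inductionOn with
    | h y => rw [hF (hf s y), hF (rel_eq_star_iff.2 (hf s y))]
  let σ (s : S.Elem) : Equiv.Perm (Quotient R) :=
    ⟨F s, F (S.star s), hinv s, fun q => hinv (S.star s) q⟩
  have hmul {x y z : X} : σ (S.rel x z) = σ (S.rel x y) * σ (S.rel y z) := by
    ext q
    induction q using Quotient.inductionOn with
    | h w =>
      obtain ⟨v, hv⟩ := exists_rel_eq_left w (S.rel x z)
      have : S.rel v w ∈ ({S.rel x y} * {S.rel y z} : Set S.Elem) :=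
        hv ▸ rel_mem_mul.2 ⟨y, rfl, rfl⟩
      obtain ⟨t, h1, h2⟩ := rel_mem_mul.1 this
      change F (S.rel x z) (Quotient.mk R w) =
        F (S.rel x y) (F (S.rel y z) (Quotient.mk R w))
      rw [hF hv, hF h2, hF h1]
  have hone (s : S.Elem) : σ s = 1 ↔ s ∈ P := by
    constructor
    · intro h
      obtain ⟨x, y, rfl⟩ := exists_rel_eq s
      have h1 : σ (S.rel x y) (Quotient.mk R y) = Quotient.mk R x := hF rfl
      rw [h, Equiv.Perm.one_apply] at h1
      exact hP.symm (Quotient.exact h1)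
    · intro h
      ext q
      induction q using Quotient.inductionOn with
      | h y => exact Quotient.sound ((hf s y).symm ▸ h : S.rel (f s y) y ∈ P)
  let G : Subgroup (Equiv.Perm (Quotient R)) :=
    { carrier := Set.range σ
      one_mem' := ⟨S.one, (hone _).2 hP.one_mem⟩
      mul_mem' := by
        rintro _ _ ⟨s, rfl⟩ ⟨t, rfl⟩
        obtain ⟨x, y, rfl⟩ := exists_rel_eq s
        obtain ⟨z, rfl⟩ := exists_rel_eq_right y t
        exact ⟨_, hmul⟩
      inv_mem' := by
        rintro _ ⟨s, rfl⟩
        exact ⟨S.star s, rfl⟩ }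
  refine ⟨G, inferInstance, inferInstance, fun s => ⟨σ s, s, rfl⟩, fun x y z => Subtype.ext hmul,
    ?_, fun s => ?_⟩
  · rintro ⟨_, s, rfl⟩
    exact ⟨s, rfl⟩
  · rw [← hone]
    exact Subtype.ext_iff

namespace IsGroupMorphism

variable {G : Type*} [Group G] {φ : S.Elem → G}

theorem map_one (hφ : IsGroupMorphism φ) : φ S.one = 1 := by
  obtain ⟨x⟩ := S.nonempty_points
  have := hφ x x x
  rwa [rel_self, left_eq_mul] at this

theorem map_rel_symm (hφ : IsGroupMorphism φ) (x y : X) :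
    φ (S.rel y x) = (φ (S.rel x y))⁻¹ := by
  rw [eq_inv_iff_mul_eq_one, ← hφ, rel_self, hφ.map_one]

/-- The image of a closed subset is a subgroup. -/
def image (hφ : IsGroupMorphism φ) {T : Set S.Elem} (hT : S.IsClosedSubset T) : Subgroup G where
  carrier := φ '' T
  one_mem' := ⟨S.one, hT.one_mem, hφ.map_one⟩
  mul_mem' := by
    rintro _ _ ⟨s, hs, rfl⟩ ⟨t, ht, rfl⟩
    obtain ⟨x, y, rfl⟩ := exists_rel_eq s
    obtain ⟨z, rfl⟩ := exists_rel_eq_right y t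
    exact ⟨S.rel x z, hT.trans hs ht, hφ x y z⟩
  inv_mem' := by
    rintro _ ⟨s, hs, rfl⟩
    obtain ⟨x, y, rfl⟩ := exists_rel_eq s
    exact ⟨S.rel y x, hT.symm hs, hφ.map_rel_symm x y⟩

theorem isClosedSubset_preimage (hφ : IsGroupMorphism φ) (H : Subgroup G) :
    S.IsClosedSubset (φ ⁻¹' H) := by
  refine IsClosedSubset.of_rel ?_ fun x y z hy hz => ?_
  · obtain ⟨x⟩ := S.nonempty_points
    refine ⟨x, ?_⟩
    rw [rel_self, Set.mem_preimage, hφ.map_one]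
    exact H.one_mem
  · rw [Set.mem_preimage, hφ y x z, hφ.map_rel_symm x y]
    exact H.mul_mem (H.inv_mem hy) hz

/-- On the points `T`-related to `x`, the fibres of `y ↦ φ (S.rel x y)` are the classes of `T ∩ P`.
-/
theorem setValency_eq (hφ : IsGroupMorphism φ) {P : Set S.Elem} (hP : ∀ s, φ s = 1 ↔ s ∈ P)
    {T : Set S.Elem} (hT : S.IsClosedSubset T) :
    S.setValency T = Nat.card (hφ.image hT) * S.setValency (T ∩ P) := by
  obtain ⟨x⟩ := S.nonempty_points
  rw [setValency_eq_ncard T x, Set.ncard_eq_ncard_image_mul _ (fun y => φ (S.rel x y))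
    (S.setValency (T ∩ P))]
  · congr 1
    refine (congrArg Set.ncard (?_ : _ = φ '' T)).trans (Nat.card_coe_set_eq _).symm
    ext g
    constructor
    · rintro ⟨y, hy, rfl⟩
      exact ⟨_, hy, rfl⟩
    · rintro ⟨s, hs, rfl⟩
      obtain ⟨y, rfl⟩ := exists_rel_eq_right x s
      exact ⟨y, hs, rfl⟩
  · intro y hy
    rw [setValency_eq_ncard (T ∩ P) y]
    congr 1
    ext z
    change S.rel x z ∈ T ∧ φ (S.rel x z) = φ (S.rel x y) ↔ S.rel y z ∈ T ∧ S.rel y z ∈ P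
    rw [← hP, hφ x y z, mul_eq_left]
    exact and_congr_left fun _ => ⟨fun h => hT.rel_mem hy h, fun h => hT.trans hy h⟩

theorem image_preimage (hφ : IsGroupMorphism φ) (hs : Function.Surjective φ) (H : Subgroup G) :
    hφ.image (hφ.isClosedSubset_preimage H) = H :=
  SetLike.coe_injective (Set.image_preimage_eq _ hs)

theorem setValency_preimage (hφ : IsGroupMorphism φ) (hs : Function.Surjective φ)
    {P : Set S.Elem} (hP : ∀ s, φ s = 1 ↔ s ∈ P) (H : Subgroup G) :
    S.setValency (φ ⁻¹' H) = Nat.card H * S.setValency P := by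
  rw [hφ.setValency_eq hP (hφ.isClosedSubset_preimage H), hφ.image_preimage hs]
  congr 2
  refine Set.inter_eq_right.2 fun s hsP => ?_
  rw [Set.mem_preimage, (hP s).2 hsP]
  exact H.one_mem

theorem index_preimage (hφ : IsGroupMorphism φ) (hs : Function.Surjective φ)
    {P : Set S.Elem} (hP : ∀ s, φ s = 1 ↔ s ∈ P) (H : Subgroup G) [Finite G] :
    S.index (φ ⁻¹' H) Set.univ = H.index := by
  have h1 := hφ.setValency_preimage hs hP ⊤
  rw [Subgroup.coe_top, Set.preimage_univ, Subgroup.card_top, ← H.card_mul_index] at h1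
  have hpos : 0 < S.setValency P := setValency_pos ⟨S.one, (hP _).1 hφ.map_one⟩
  rw [index, h1, hφ.setValency_preimage hs hP, mul_right_comm]
  exact Nat.mul_div_cancel_left _ (Nat.mul_pos Nat.card_pos hpos)

/-- Let `W` be the part of `U` lying over the image of `T`. Since `W` and `U` meet `P` in the same
set, the left side is `n_U / n_W`, and `T ⊆ W`. -/
theorem relIndex_dvd (hφ : IsGroupMorphism φ) {P : Set S.Elem} (hP : ∀ s, φ s = 1 ↔ s ∈ P)
    {T U : Set S.Elem} (hT : S.IsClosedSubset T) (hU : S.IsClosedSubset U) (hTU : T ⊆ U) :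
    (hφ.image hT).relIndex (hφ.image hU) ∣ S.index T U := by
  have hle : hφ.image hT ≤ hφ.image hU := Set.image_mono hTU
  have hW := hU.inter (hφ.isClosedSubset_preimage (hφ.image hT))
  have hTW : T ⊆ U ∩ φ ⁻¹' (hφ.image hT : Set G) := fun t ht => ⟨hTU ht, t, ht, rfl⟩
  have himage : hφ.image hW = hφ.image hT := by
    apply SetLike.coe_injective
    refine Set.Subset.antisymm ?_ (Set.image_mono hTW)
    rintro _ ⟨s, hs, rfl⟩
    exact hs.2
  have hinter : U ∩ φ ⁻¹' (hφ.image hT : Set G) ∩ P = U ∩ P := by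
    ext s
    refine ⟨fun h => ⟨h.1.1, h.2⟩, fun h => ⟨⟨h.1, ?_⟩, h.2⟩⟩
    rw [Set.mem_preimage, (hP s).2 h.2]
    exact (hφ.image hT).one_mem
  obtain ⟨k, hk⟩ := hT.setValency_dvd hW hTW
  have e1 := hφ.setValency_eq hP hU
  have e2 := hφ.setValency_eq hP hW
  have e3 := hT.setValency_eq_mul_index hU hTU
  have e4 := Subgroup.relIndex_mul_relIndex ⊥ _ _ bot_le hle
  rw [Subgroup.relIndex_bot_left, Subgroup.relIndex_bot_left] at e4
  rw [himage, hinter, hk] at e2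
  refine ⟨k, Nat.eq_of_mul_eq_mul_left (setValency_pos hT.1) ?_⟩
  rw [← e3, e1, ← e4, mul_right_comm, ← e2]
  ring

theorem isSolvable [Finite G] (hφ : IsGroupMorphism φ) (hs : Function.Surjective φ)
    {P : Set S.Elem} (hP : ∀ s, φ s = 1 ↔ s ∈ P) (hsolv : S.IsSolvable) :
    Group.IsSolvable G := by
  obtain ⟨n, T, hc, h0, hn, hT⟩ := hsolv
  -- `T i` need not be closed for `i > n`, so the series is truncated to give a subgroup for every
  -- index.
  have hc' (i : ℕ) : S.IsClosedSubset (T (min i n)) := hc _ (min_le_right i n)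
  have hmin {i : ℕ} (h : i ≤ n) : T (min i n) = T i := by rw [min_eq_left h]
  refine isSolvable_of_relIndex_chain (n := n) (fun i => hφ.image (hc' i)) ?_ ?_ ?_ ?_ ?_
  · refine SetLike.coe_injective ?_
    change φ '' _ = {1}
    rw [hmin (Nat.zero_le n), h0, Set.image_singleton, hφ.map_one]
  · refine SetLike.coe_injective ?_
    change φ '' _ = Set.univ
    rw [hmin le_rfl, hn, Set.image_univ, hs.range_eq]
  · intro i hi
    refine Set.image_mono ?_
    rw [hmin hi.le, hmin hi]
    exact (hT i hi).1.1
  · intro i hi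
    refine ⟨?_⟩
    rintro ⟨_, _⟩ ⟨t, ht, rfl⟩ ⟨_, v, hv, rfl⟩
    rw [hmin hi] at hv
    rw [hmin hi.le] at ht
    obtain ⟨x, y, rfl⟩ := exists_rel_eq t
    obtain ⟨x', rfl⟩ := exists_rel_eq_left x v
    obtain ⟨y', hy'⟩ := exists_rel_eq_left y (S.rel x' x)
    have hx'y' : S.rel x' y' ∈ T i := (hT i hi).1.rel_mem ((hc (i + 1) hi).star_mem hv)
      (star_rel x' x).symm (rel_eq_star_iff.2 hy') ht
    refine ⟨S.rel x' y', by rwa [hmin hi.le], ?_⟩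
    change φ (S.rel x' y') = φ (S.rel x' x) * φ (S.rel x y) * (φ (S.rel x' x))⁻¹
    rw [← hy', ← hφ.map_rel_symm, hy', ← hφ, ← hφ]
  · intro i hi
    have hsub := (hT i hi).1.1
    have hp := (hT i hi).2
    rw [← hmin hi.le, ← hmin hi] at hsub hp
    rcases (Nat.dvd_prime hp).1 (hφ.relIndex_dvd hP (hc' i) (hc' (i + 1)) hsub) with h | h
    · exact Or.inl h
    · exact Or.inr (h.symm ▸ hp)

end IsGroupMorphism

end AssociationScheme

/-! ### Transfer of Hall's theorem from the quotient group to the scheme -/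

open AssociationScheme in
theorem mainTheorem1 {X : Type*} [Finite X] (S : AssociationScheme X)
    (π : Set ℕ) (hπ : ∀ p ∈ π, p.Prime) (hsolv : S.IsSolvable) (hval : S.IsPiValenced π) :
    (∃ T : Set S.Elem, S.IsHallPiSubset π T) ∧
    (∀ T U : Set S.Elem, S.IsHallPiSubset π T → S.IsHallPiSubset π U → S.AreConjugate T U) ∧
    (∀ T : Set S.Elem, S.IsClosedPiSubset π T →
      ∃ U : Set S.Elem, S.IsHallPiSubset π U ∧ T ⊆ U) := by
  obtain ⟨P, hPc, hPn, hPπ⟩ : ∃ P, S.IsClosedSubset P ∧ S.IsStronglyNormalIn P Set.univ ∧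
      IsPiNumber π (S.setValency P) := by
    obtain ⟨n, T, hc, h0, hn, hT⟩ := hsolv
    rw [← hn]
    exact exists_isStronglyNormalIn_isPiNumber hval hc h0 fun i hi => (hT i hi).1
  obtain ⟨G, _, _, φ, hφ, hs, hP⟩ := exists_isGroupMorphism hPc hPn
  have := hφ.isSolvable hs hP hsolv
  obtain ⟨⟨H₀, hH₀⟩, hdom⟩ := Subgroup.hall_theorem π G
  have hcardle (T : Set S.Elem) (hT : S.IsClosedPiSubset π T) :
      IsPiNumber π (Nat.card (hφ.image hT.1)) :=
    hT.2.2.of_dvd ⟨_, hφ.setValency_eq hP hT.1⟩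
  have hclosed (H : Subgroup G) (hH : IsPiNumber π (Nat.card H)) :
      S.IsClosedPiSubset π (φ ⁻¹' H) :=
    ⟨hφ.isClosedSubset_preimage H, fun t _ => hval t trivial,
      hφ.setValency_preimage hs hP H ▸ hH.mul hPπ⟩
  have hHall (H : Subgroup G) (hH : H.IsHall π) : S.IsHallPiSubset π (φ ⁻¹' H) :=
    ⟨hclosed H hH.1, (hφ.index_preimage hs hP H).symm ▸ hH.2⟩
  -- The preimage of the image of `T` is again a closed `π`-subset. The index of `T` in it divides
  -- both a `π`-number and a `π'`-number, so `T` is the whole preimage.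
  have hHall' (T : Set S.Elem) (hT : S.IsHallPiSubset π T) :
      ∃ H : Subgroup G, H.IsHall π ∧ T = φ ⁻¹' H := by
    have hH := hcardle T hT.1
    have hcl := hclosed _ hH
    have hTH : T ⊆ φ ⁻¹' (hφ.image hT.1.1 : Set G) := Set.subset_preimage_image φ T
    have h1 := hT.1.1.setValency_eq_mul_index hcl.1 hTH
    have h2 := hcl.1.setValency_eq_mul_index (IsClosedSubset.univ S) (Set.subset_univ _)
    have h3 := hT.1.1.setValency_eq_mul_index (IsClosedSubset.univ S) (Set.subset_univ _)
    have h4 : S.index T Set.univ = S.index T (φ ⁻¹' (hφ.image hT.1.1 : Set G)) *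
        S.index (φ ⁻¹' (hφ.image hT.1.1 : Set G)) Set.univ := by
      refine Nat.eq_of_mul_eq_mul_left hT.1.2.2.1 ?_
      rw [← mul_assoc, ← h1, ← h2, ← h3]
    have h5 : S.index T (φ ⁻¹' (hφ.image hT.1.1 : Set G)) = 1 :=
      Nat.eq_one_of_dvd_coprimes (hcl.2.2.coprime hT.2) ⟨_, h1.trans (mul_comm _ _)⟩ ⟨_, h4⟩
    have h6 : T = φ ⁻¹' (hφ.image hT.1.1 : Set G) :=
      eq_of_subset_of_setValency_le hTH (by rw [h1, h5, mul_one])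
    refine ⟨hφ.image hT.1.1, ⟨hH, ?_⟩, h6⟩
    rw [← hφ.index_preimage hs hP, ← h6]
    exact hT.2
  refine ⟨⟨_, hHall H₀ hH₀⟩, fun T U hT hU => ?_, fun T hT => ?_⟩
  · obtain ⟨H, hH, rfl⟩ := hHall' T hT
    obtain ⟨K, hK, rfl⟩ := hHall' U hU
    obtain ⟨g, hg⟩ := hdom K H hK hH.1
    have hL := hH.map_conj g⁻¹
    have hLK := hL.eq_of_le hK (by
      rintro _ ⟨h, hh, rfl⟩
      simpa using hg h hh)
    -- Any `s` over the conjugating element works: `s* φ⁻¹(H) s` is the full preimage of the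
    -- conjugate of `H`.
    obtain ⟨s, rfl⟩ := hs g
    refine ⟨s, Set.ext fun t => ?_⟩
    obtain ⟨x, y, rfl⟩ := exists_rel_eq t
    rw [rel_mem_conj]
    constructor
    · rintro ⟨x', y', hx, hy, hxy⟩
      have := hg _ hxy
      rw [hφ x' x y', hφ x y y', hφ.map_rel_symm y' y, hx, hy] at this
      simpa [mul_assoc] using this
    · intro hxy
      obtain ⟨x', hx⟩ := exists_rel_eq_left x s
      obtain ⟨y', hy⟩ := exists_rel_eq_left y s
      refine ⟨x', y', hx, hy, ?_⟩
      rw [Set.mem_preimage, ← hLK] at hxy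
      obtain ⟨h, hh, hhe⟩ := hxy
      rw [Set.mem_preimage, hφ x' x y', hφ x y y', hφ.map_rel_symm y' y, hx, hy, ← hhe]
      simpa [mul_assoc] using hh
  · obtain ⟨g, hg⟩ := hdom H₀ _ hH₀ (hcardle T hT)
    refine ⟨φ ⁻¹' (H₀.map (MulAut.conj g).toMonoidHom : Subgroup G), hHall _ (hH₀.map_conj g),
      fun t ht => ?_⟩
    exact ⟨_, hg _ ⟨t, ht, rfl⟩, by simp [mul_assoc]⟩
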